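/- Let $\mu$ be a probability measure on $\mathbb{Z}$ with $\mu(x)>0$ for all $x\in\mathbb{Z}$, and define $$c_\mu(x,y)=\log\left(\frac{\mu\left(\left\lfloor \frac{x+y}{2}\right\rfloor\right)\mu\left(\left\lceil \frac{x+y}{2}\right\rceil\right)}{\mu(x)\mu(y)}\right),\qquad x,y\in\mathbb{Z}.$$ For probability measures $\nu_0,\nu_1$ on $\mathbb{Z}$, let $\Pi(\nu_0,\nu_1)$ be the set of probability measures on $\mathbb{Z}^2$ with first marginal $\nu_0$ and second marginal $\nu_1$, and let $$\mathcal{T}_{c_\mu}(\nu_0,\nu_1)=\inf_{\pi\in\Pi(\nu_0,\nu_1)}\iint c_\mu(x,y)\,d\pi(x,y)\in[-\infty,+\infty],$$ where $\iint c_\mu\,d\pi=\iint c_\mu^+\,d\pi-\iint c_\mu^-\,d\pi\in[-\infty,+\infty]$, the infimum runs over those $\pi$ for which $\iint c_\mu^+\,d\pi$ and $\iint c_\mu^-\,d\pi$ are not both infinite, and $\inf\emptyset=+\infty$. Let $H(\nu|\mu)=\sum_{x\in\mathbb{Z}}\nu(x)\log\frac{\nu(x)}{\mu(x)}\in[0,+\infty]$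 denote the relative entropy (with $0\log 0=0$). Then for all probability measures $\nu_0,\nu_1$ on $\mathbb{Z}$, $$\mathcal{T}_{c_\mu}(\nu_0,\nu_1)\le H(\nu_0|\mu)+H(\nu_1|\mu).$$ -/

import Mathlib

open MeasureTheory
open scoped ENNReal

noncomputable section

/-- The midpoint cost `c_μ(x, y) = log (μ(⌊(x+y)/2⌋) μ(⌈(x+y)/2⌉) / (μ(x) μ(y)))` on `ℤ × ℤ`. -/
def midpointCost (μ : Measure ℤ) (p : ℤ × ℤ) : ℝ :=
  Real.log ((μ.real {⌊((p.1 : ℝ) + (p.2 : ℝ)) / 2⌋} * μ.real {⌈((p.1 : ℝ) + (p.2 : ℝ)) / 2⌉}) /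
    (μ.real {p.1} * μ.real {p.2}))

/-- The set `Π(ν₀, ν₁)` of probability measures on the product with marginals `ν₀` and `ν₁`. -/
def couplings {X Y : Type*} [MeasurableSpace X] [MeasurableSpace Y]
    (ν₀ : Measure X) (ν₁ : Measure Y) : Set (Measure (X × Y)) :=
  {π | IsProbabilityMeasure π ∧ π.map Prod.fst = ν₀ ∧ π.map Prod.snd = ν₁}

/-- The integral of `f` against `π` is meaningful in `[-∞, ∞]`: the positive and the negative part
of `f` do not both have infinite integral. -/
def HasExtIntegral {Z : Type*} [MeasurableSpace Z] (f : Z → ℝ) (π : Measure Z) : Prop :=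
  ∫⁻ z, ENNReal.ofReal (f z) ∂π ≠ ∞ ∨ ∫⁻ z, ENNReal.ofReal (-f z) ∂π ≠ ∞

/-- The extended integral `∫ f⁺ dπ - ∫ f⁻ dπ ∈ [-∞, ∞]`; only used under `HasExtIntegral f π`. -/
def extIntegral {Z : Type*} [MeasurableSpace Z] (f : Z → ℝ) (π : Measure Z) : EReal :=
  ((∫⁻ z, ENNReal.ofReal (f z) ∂π : ℝ≥0∞) : EReal) -
    ((∫⁻ z, ENNReal.ofReal (-f z) ∂π : ℝ≥0∞) : EReal)

/-- The optimal transport cost `T_c(ν₀, ν₁) = inf_{π ∈ Π(ν₀, ν₁)} ∬ c dπ ∈ [-∞, ∞]`, the infimum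
running over the couplings for which the integral is meaningful (`inf ∅ = +∞`). -/
def transportCost {X Y : Type*} [MeasurableSpace X] [MeasurableSpace Y]
    (c : X × Y → ℝ) (ν₀ : Measure X) (ν₁ : Measure Y) : EReal :=
  ⨅ π ∈ {π ∈ couplings ν₀ ν₁ | HasExtIntegral c π}, extIntegral c π

end

open Set

/-! The comonotone coupling already achieves the bound. It lives on a lattice path `s ↦ (x s, y s)`
with `x s + y s = s` and is the image of `ρ`, the law of the coordinate sum. Let `q`, `q'` be the
images of `ρ` under `s ↦ ⌊s/2⌋`, `⌈s/2⌉`. At atoms of `ρ` the cost is the sum of the two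
log-densities `log (νᵢ/μ)`, whose means are the entropies, of `log (μ/q)` and `log (μ/q')` at the
midpoints, and of `log (q q' / (ν₀ ν₁))`. By `log t ≤ t - 1`, it suffices that the last three
arguments have `ρ`-mean at most 1.

For `μ/q` and `μ/q'` this is a change of variables. For the remaining ratio, `q q' = (ρ(s-1) + ρ(s))
(ρ(s) + ρ(s+1))`. Its weighted value can exceed `ρ(s)` at a single `s`, but by at most a discrete
Laplacian: `d(s) - (d(s-1) + d(s+1))/2` with `d = straightDefect` (`mul_midpointRatio_le`). As `d`
is summable, this correction sums to zero. -/

/-! ### Pointwise Laplacian bound along a lattice path -/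

/-- Deficit attached to a step of a lattice path: nonzero only at the middle of three consecutive
points lying on one horizontal or vertical line. -/
noncomputable def straightDefect (ρ : Measure ℤ) (x y : ℤ → ℤ) (s : ℤ) : ℝ :=
  if x (s - 1) = x (s + 1) then
    ρ.real {s - 1} * ρ.real {s + 1} / (ρ.map x).real {x s}
  else if y (s - 1) = y (s + 1) then
    ρ.real {s - 1} * ρ.real {s + 1} / (ρ.map y).real {y s}
  else 0

lemma sum_real_singleton_le_map (ρ : Measure ℤ) [IsFiniteMeasure ρ] (x : ℤ → ℤ) (n : ℤ)
    (A : Finset ℤ) (hA : ∀ t ∈ A, x t = n) :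
    ∑ t ∈ A, ρ.real {t} ≤ (ρ.map x).real {n} := by
  rw [map_measureReal_apply (measurable_of_countable x) (measurableSet_singleton n),
    sum_measureReal_singleton]
  exact measureReal_mono (fun t ht => hA t ht)

lemma straightDefect_nonneg (ρ : Measure ℤ) (x y : ℤ → ℤ) (s : ℤ) :
    0 ≤ straightDefect ρ x y s := by
  unfold straightDefect
  split_ifs <;> positivity

lemma straightDefect_swap (ρ : Measure ℤ) {x y : ℤ → ℤ} (hxy : ∀ s, x s + y s = s) (s : ℤ) :
    straightDefect ρ x y s = straightDefect ρ y x s := by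
  have h1 := hxy (s - 1)
  have h2 := hxy (s + 1)
  unfold straightDefect
  split_ifs <;> first | rfl | omega

lemma straightDefect_of_left (ρ : Measure ℤ) {x y : ℤ → ℤ} {s : ℤ} (h : x (s - 1) = x (s + 1)) :
    straightDefect ρ x y s = ρ.real {s - 1} * ρ.real {s + 1} / (ρ.map x).real {x s} :=
  if_pos h

/-- Comparison with the masses of `ρ`, which makes the defects summable. -/
lemma straightDefect_le (ρ : Measure ℤ) [IsFiniteMeasure ρ] {x y : ℤ → ℤ} (hx : Monotone x)
    (hy : Monotone y) (s : ℤ) : straightDefect ρ x y s ≤ ρ.real {s - 1} := by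
  have key : ∀ z : ℤ → ℤ, Monotone z → z (s - 1) = z (s + 1) →
      ρ.real {s - 1} * ρ.real {s + 1} / (ρ.map z).real {z s} ≤ ρ.real {s - 1} := by
    intro z hz h
    have h1 := hz (show s - 1 ≤ s by omega)
    have h2 := hz (show s ≤ s + 1 by omega)
    have h3 := sum_real_singleton_le_map ρ z (z s) {s + 1} (by simp; omega)
    rw [Finset.sum_singleton] at h3
    rw [mul_div_assoc]
    exact mul_le_of_le_one_right measureReal_nonneg
      (div_le_one_of_le₀ h3 measureReal_nonneg)
  unfold straightDefect
  split_ifs with h h'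
  · exact key x hx h
  · exact key y hy h'
  · exact measureReal_nonneg

lemma straightDefect_succ (ρ : Measure ℤ) {x y : ℤ → ℤ} (hy : Monotone y)
    (hxy : ∀ s, x s + y s = s) {s : ℤ} (h : x (s + 1) = x s) :
    straightDefect ρ x y (s + 1) =
      ρ.real {s} * (if x (s + 2) = x s then ρ.real {s + 2} else 0) / (ρ.map x).real {x s} := by
  have h1 := hxy s
  have h2 := hxy (s + 1)
  have h3 := hy (show s + 1 ≤ s + 2 by omega)
  unfold straightDefect
  rw [show s + 1 - 1 = s by ring, show s + 1 + 1 = s + 2 by ring, h]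
  by_cases hc : x (s + 2) = x s
  · rw [if_pos hc.symm, if_pos hc]
  -- The path turns at `s + 1`: `y` has already increased from `s` to `s + 1`, so the second branch
  -- fails too.
  · rw [if_neg (Ne.symm hc), if_neg hc, if_neg (by omega)]
    simp

lemma straightDefect_pred (ρ : Measure ℤ) {x y : ℤ → ℤ} (hy : Monotone y)
    (hxy : ∀ s, x s + y s = s) {s : ℤ} (h : x (s - 1) = x s) :
    straightDefect ρ x y (s - 1) =
      ρ.real {s} * (if x (s - 2) = x s then ρ.real {s - 2} else 0) / (ρ.map x).real {x s} := by
  have h1 := hxy s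
  have h2 := hxy (s - 1)
  have h3 := hy (show s - 2 ≤ s - 1 by omega)
  unfold straightDefect
  rw [show s - 1 + 1 = s by ring, show s - 1 - 1 = s - 2 by ring, h]
  by_cases hc : x (s - 2) = x s
  · rw [if_pos hc, if_pos hc, mul_comm]
  · rw [if_neg hc, if_neg hc, if_neg (by omega)]
    simp

/-- The ratio of the product of the two pair masses around `s` to the product of the masses of the
two lines through the `s`-th point of the lattice path `(x, y)`. -/
noncomputable def midpointRatio (ρ : Measure ℤ) (x y : ℤ → ℤ) (s : ℤ) : ℝ :=
  (ρ.real {s - 1} + ρ.real {s}) * (ρ.real {s} + ρ.real {s + 1}) /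
    ((ρ.map x).real {x s} * (ρ.map y).real {y s})

lemma midpointRatio_nonneg (ρ : Measure ℤ) (x y : ℤ → ℤ) (s : ℤ) :
    0 ≤ midpointRatio ρ x y s := by
  unfold midpointRatio
  positivity

lemma midpointRatio_swap (ρ : Measure ℤ) (x y : ℤ → ℤ) (s : ℤ) :
    midpointRatio ρ x y s = midpointRatio ρ y x s := by
  unfold midpointRatio
  rw [mul_comm ((ρ.map x).real _)]

/-- With masses `u, p, v` at `s-1, s, s+1` and line mass `a`, `(u+p)(p+v) = uv + p(u+p+v)`. The term
`uv/a` is the defect at `s`; the far points `s ± 2`, when on the line, leave room in `a` for the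
neighbouring defects. -/
lemma mul_midpointRatio_le_of_straight (ρ : Measure ℤ) [IsFiniteMeasure ρ] {x y : ℤ → ℤ}
    (hy : Monotone y) (hxy : ∀ s, x s + y s = s) {s : ℤ}
    (hs : 0 < ρ.real {s}) (h1 : x (s - 1) = x s) (h2 : x (s + 1) = x s) :
    ρ.real {s} * midpointRatio ρ x y s ≤ ρ.real {s} + straightDefect ρ x y s -
      (straightDefect ρ x y (s - 1) + straightDefect ρ x y (s + 1)) / 2 := by
  have hb := sum_real_singleton_le_map ρ y (y s) {s} (by simp)
  have ha : (if x (s - 2) = x s then ρ.real {s - 2} else 0) + ρ.real {s - 1} + ρ.real {s} +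
      ρ.real {s + 1} + (if x (s + 2) = x s then ρ.real {s + 2} else 0) ≤
      (ρ.map x).real {x s} := by
    have := sum_real_singleton_le_map ρ x (x s)
      (({s - 2, s - 1, s, s + 1, s + 2} : Finset ℤ).filter (fun t => x t = x s)) (by simp)
    rw [Finset.sum_filter, Finset.sum_insert (by simp; omega), Finset.sum_insert (by simp; omega),
      Finset.sum_insert (by simp), Finset.sum_insert (by simp), Finset.sum_singleton,
      if_pos h1, if_pos h2, if_pos rfl] at this
    linarith
  rw [Finset.sum_singleton] at hb
  rw [straightDefect_pred ρ hy hxy h1, straightDefect_succ ρ hy hxy h2,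
    straightDefect_of_left ρ (h1.trans h2.symm)]
  unfold midpointRatio
  have hp1 : 0 ≤ ρ.real {s - 1} := measureReal_nonneg
  have hp2 : 0 ≤ ρ.real {s + 1} := measureReal_nonneg
  have hr1 : 0 ≤ (if x (s - 2) = x s then ρ.real {s - 2} else 0) := by positivity
  have hr2 : 0 ≤ (if x (s + 2) = x s then ρ.real {s + 2} else 0) := by positivity
  generalize (if x (s - 2) = x s then ρ.real {s - 2} else 0) = r at *
  generalize (if x (s + 2) = x s then ρ.real {s + 2} else 0) = r' at *
  generalize (ρ.map x).real {x s} = a at *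
  generalize (ρ.map y).real {y s} = b at *
  generalize ρ.real {s} = p at *
  generalize ρ.real {s - 1} = u at *
  generalize ρ.real {s + 1} = v at *
  have ha0 : 0 < a := by linarith
  have hb0 : 0 < b := by linarith
  calc p * ((u + p) * (p + v) / (a * b)) = (p / b) * ((u + p) * (p + v) / a) := by
        field_simp
    _ ≤ 1 * ((u + p) * (p + v) / a) := by
        gcongr
        exact div_le_one_of_le₀ hb hb0.le
    _ ≤ p + u * v / a - (p * r / a + p * r' / a) / 2 := by
        rw [← sub_nonneg]
        have : p + u * v / a - (p * r / a + p * r' / a) / 2 - 1 * ((u + p) * (p + v) / a) =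
            p * (a - u - p - v - r / 2 - r' / 2) / a := by
          field_simp
          ring
        rw [this]
        have : 0 ≤ a - u - p - v - r / 2 - r' / 2 := by linarith
        positivity

/-- At a corner the ratio is a product of two fractions, at most `1 - r/a` and `1 - r'/b`. Both lie
in `[0, 1]`, so the product is at most each of them, hence at most their average. -/
lemma mul_midpointRatio_le_of_corner (ρ : Measure ℤ) [IsFiniteMeasure ρ] {x y : ℤ → ℤ}
    (hx : Monotone x) (hy : Monotone y) (hxy : ∀ s, x s + y s = s) {s : ℤ}
    (hs : 0 < ρ.real {s}) (h1 : x (s - 1) = x s) (h2 : y (s + 1) = y s) :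
    ρ.real {s} * midpointRatio ρ x y s ≤ ρ.real {s} + straightDefect ρ x y s -
      (straightDefect ρ x y (s - 1) + straightDefect ρ x y (s + 1)) / 2 := by
  have ha : (if x (s - 2) = x s then ρ.real {s - 2} else 0) + ρ.real {s - 1} + ρ.real {s} ≤
      (ρ.map x).real {x s} := by
    have := sum_real_singleton_le_map ρ x (x s)
      (({s - 2, s - 1, s} : Finset ℤ).filter (fun t => x t = x s)) (by simp)
    rw [Finset.sum_filter, Finset.sum_insert (by simp), Finset.sum_insert (by simp),
      Finset.sum_singleton, if_pos h1, if_pos rfl] at this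
    linarith
  have hb : ρ.real {s} + ρ.real {s + 1} + (if y (s + 2) = y s then ρ.real {s + 2} else 0) ≤
      (ρ.map y).real {y s} := by
    have := sum_real_singleton_le_map ρ y (y s)
      (({s, s + 1, s + 2} : Finset ℤ).filter (fun t => y t = y s)) (by simp)
    rw [Finset.sum_filter, Finset.sum_insert (by simp), Finset.sum_insert (by simp),
      Finset.sum_singleton, if_pos h2, if_pos rfl] at this
    linarith
  have hd := straightDefect_nonneg ρ x y s
  rw [straightDefect_pred ρ hy hxy h1, straightDefect_swap ρ hxy (s + 1),
    straightDefect_succ ρ hx (fun t => (add_comm _ _).trans (hxy t)) h2]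
  unfold midpointRatio
  have hp1 : 0 ≤ ρ.real {s - 1} := measureReal_nonneg
  have hp2 : 0 ≤ ρ.real {s + 1} := measureReal_nonneg
  have hr1 : 0 ≤ (if x (s - 2) = x s then ρ.real {s - 2} else 0) := by positivity
  have hr2 : 0 ≤ (if y (s + 2) = y s then ρ.real {s + 2} else 0) := by positivity
  generalize (if x (s - 2) = x s then ρ.real {s - 2} else 0) = r at *
  generalize (if y (s + 2) = y s then ρ.real {s + 2} else 0) = r' at *
  generalize (ρ.map x).real {x s} = a at *
  generalize (ρ.map y).real {y s} = b at *
  generalize ρ.real {s} = p at *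
  generalize ρ.real {s - 1} = u at *
  generalize ρ.real {s + 1} = v at *
  have ha0 : 0 < a := by linarith
  have hb0 : 0 < b := by linarith
  have ht : (u + p) / a ≤ 1 - r / a := by
    rw [one_sub_div ha0.ne']
    gcongr
    linarith
  have ht' : (p + v) / b ≤ 1 - r' / b := by
    rw [one_sub_div hb0.ne']
    gcongr
    linarith
  have h0 : 0 ≤ (u + p) / a := by positivity
  have h0' : 0 ≤ (p + v) / b := by positivity
  have h3 : 0 ≤ r / a := by positivity
  have h3' : 0 ≤ r' / b := by positivity
  have key : (u + p) / a * ((p + v) / b) ≤ 1 - (r / a + r' / b) / 2 := by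
    have e1 := mul_le_of_le_one_right h0 (ht'.trans (by linarith))
    have e2 := mul_le_of_le_one_left h0' (ht.trans (by linarith))
    linarith
  calc p * ((u + p) * (p + v) / (a * b)) = p * ((u + p) / a * ((p + v) / b)) := by
        rw [div_mul_div_comm]
    _ ≤ p * (1 - (r / a + r' / b) / 2) := by gcongr
    _ = p - (p * r / a + p * r' / b) / 2 := by ring
    _ ≤ _ := by linarith

lemma mul_midpointRatio_le (ρ : Measure ℤ) [IsFiniteMeasure ρ] {x y : ℤ → ℤ}
    (hx : Monotone x) (hy : Monotone y) (hxy : ∀ s, x s + y s = s) (s : ℤ) :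
    ρ.real {s} * midpointRatio ρ x y s ≤ ρ.real {s} + straightDefect ρ x y s -
      (straightDefect ρ x y (s - 1) + straightDefect ρ x y (s + 1)) / 2 := by
  have hyx : ∀ s, y s + x s = s := fun t => (add_comm _ _).trans (hxy t)
  rcases (measureReal_nonneg (μ := ρ) (s := {s})).eq_or_lt with h0 | hs
  -- The mass at `s` is a factor of both neighbouring defects.
  · have e1 : straightDefect ρ x y (s - 1) = 0 := by
      unfold straightDefect
      simp [← h0]
    have e2 : straightDefect ρ x y (s + 1) = 0 := by
      unfold straightDefect
      simp [← h0]
    have := straightDefect_nonneg ρ x y s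
    rw [e1, e2, ← h0]
    linarith
  · have a1 := hx (show s - 1 ≤ s by omega)
    have a2 := hx (show s ≤ s + 1 by omega)
    have b1 := hy (show s - 1 ≤ s by omega)
    have b2 := hy (show s ≤ s + 1 by omega)
    have c0 := hxy s
    have c1 := hxy (s - 1)
    have c2 := hxy (s + 1)
    by_cases h1 : x (s - 1) = x s
    · by_cases h2 : x (s + 1) = x s
      · exact mul_midpointRatio_le_of_straight ρ hy hxy hs h1 h2
      · exact mul_midpointRatio_le_of_corner ρ hx hy hxy hs h1 (by omega)
    · simp only [midpointRatio_swap ρ x y, straightDefect_swap ρ hxy]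
      by_cases h2 : x (s + 1) = x s
      · exact mul_midpointRatio_le_of_corner ρ hy hx hyx hs (by omega) h2
      · exact mul_midpointRatio_le_of_straight ρ hx hyx hs (by omega) (by omega)

/-! ### Ratios of mean at most one -/

lemma hasSum_measureReal_singleton (ρ : Measure ℤ) [IsProbabilityMeasure ρ] :
    HasSum (fun s => ρ.real {s}) 1 := by
  have h : ∑' s, ρ {s} = 1 := by
    simpa using (lintegral_countable' (μ := ρ) (fun _ => 1)).symm
  have h' := (ENNReal.summable_toReal (h ▸ ENNReal.one_ne_top)).hasSum
  rwa [← ENNReal.tsum_toReal_eq fun s => measure_ne_top _ _, h, ENNReal.toReal_one] at h'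

lemma hasSum_int_sub_one {d : ℤ → ℝ} {D : ℝ} (hd : HasSum d D) :
    HasSum (fun s => d (s - 1)) D :=
  (Equiv.subRight (1 : ℤ)).hasSum_iff.2 hd

lemma hasSum_int_add_one {d : ℤ → ℝ} {D : ℝ} (hd : HasSum d D) :
    HasSum (fun s => d (s + 1)) D :=
  (Equiv.addRight (1 : ℤ)).hasSum_iff.2 hd

lemma summable_and_tsum_mul_midpointRatio_le (ρ : Measure ℤ) [IsProbabilityMeasure ρ]
    {x y : ℤ → ℤ} (hx : Monotone x) (hy : Monotone y) (hxy : ∀ s, x s + y s = s) :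
    Summable (fun s => ρ.real {s} * midpointRatio ρ x y s) ∧
      ∑' s, ρ.real {s} * midpointRatio ρ x y s ≤ 1 := by
  have hp := hasSum_measureReal_singleton ρ
  have hp1 : Summable (fun s : ℤ => ρ.real {s - 1}) :=
    (hasSum_int_sub_one (d := fun t => ρ.real {t}) hp).summable
  have hD : HasSum (straightDefect ρ x y) (∑' s, straightDefect ρ x y s) :=
    (Summable.of_nonneg_of_le (straightDefect_nonneg ρ x y)
      (straightDefect_le ρ hx hy) hp1).hasSum
  generalize ∑' s, straightDefect ρ x y s = D at hD
  have hd1 : HasSum (fun s => straightDefect ρ x y (s - 1)) D := hasSum_int_sub_one hD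
  have hd2 : HasSum (fun s => straightDefect ρ x y (s + 1)) D := hasSum_int_add_one hD
  have hR : HasSum (fun s => ρ.real {s} + straightDefect ρ x y s -
      (straightDefect ρ x y (s - 1) + straightDefect ρ x y (s + 1)) / 2)
      (1 + D - (D + D) / 2) := (hp.add hD).sub ((hd1.add hd2).div_const 2)
  have hT : Summable (fun s => ρ.real {s} * midpointRatio ρ x y s) :=
    Summable.of_nonneg_of_le
      (fun s => mul_nonneg measureReal_nonneg (midpointRatio_nonneg ρ x y s))
      (mul_midpointRatio_le ρ hx hy hxy) hR.summable
  refine ⟨hT, (hasSum_le (mul_midpointRatio_le ρ hx hy hxy) hT.hasSum hR).trans ?_⟩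
  linarith

lemma lintegral_midpointRatio_le (ρ : Measure ℤ) [IsProbabilityMeasure ρ] {x y : ℤ → ℤ}
    (hx : Monotone x) (hy : Monotone y) (hxy : ∀ s, x s + y s = s) :
    ∫⁻ s, ENNReal.ofReal (midpointRatio ρ x y s) ∂ρ ≤ 1 := by
  obtain ⟨hT, hle⟩ := summable_and_tsum_mul_midpointRatio_le ρ hx hy hxy
  have hT0 : ∀ s, 0 ≤ ρ.real {s} * midpointRatio ρ x y s := fun s =>
    mul_nonneg measureReal_nonneg (midpointRatio_nonneg ρ x y s)
  have hterm : ∀ s, ENNReal.ofReal (midpointRatio ρ x y s) * ρ {s} =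
      ENNReal.ofReal (ρ.real {s} * midpointRatio ρ x y s) := fun s => by
    rw [ENNReal.ofReal_mul measureReal_nonneg, ofReal_measureReal, mul_comm]
  rw [lintegral_countable', tsum_congr hterm, ← ENNReal.ofReal_tsum_of_nonneg hT0 hT]
  exact ENNReal.ofReal_le_one.2 hle

lemma lintegral_ratio_map_le (ρ μ : Measure ℤ) [IsProbabilityMeasure ρ] [IsProbabilityMeasure μ]
    (f : ℤ → ℤ) :
    ∫⁻ s, ENNReal.ofReal (μ.real {f s} / (ρ.map f).real {f s}) ∂ρ ≤ 1 := by
  have hf : Measurable f := measurable_of_countable f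
  have := Measure.isProbabilityMeasure_map (μ := ρ) hf.aemeasurable
  rw [← lintegral_map (f := fun j => ENNReal.ofReal (μ.real {j} / (ρ.map f).real {j}))
    (measurable_of_countable _) hf, lintegral_countable']
  calc ∑' j, ENNReal.ofReal (μ.real {j} / (ρ.map f).real {j}) * (ρ.map f) {j}
      ≤ ∑' j, (1 : ℝ≥0∞) * μ {j} := by
        -- Only an inequality: points outside the support of `ρ.map f` contribute zero on the left.
        refine ENNReal.tsum_le_tsum fun j => ?_
        rw [one_mul, ← ofReal_measureReal (μ := ρ.map f), ← ENNReal.ofReal_mul (by positivity),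
          ← ofReal_measureReal (μ := μ)]
        refine ENNReal.ofReal_le_ofReal ?_
        rw [div_mul_eq_mul_div]
        exact div_le_of_le_mul₀ measureReal_nonneg measureReal_nonneg le_rfl
    _ = 1 := by
        rw [← lintegral_countable' (μ := μ) (fun _ => 1)]
        simp

/-! ### The comonotone coupling as a measure on a lattice path -/

lemma exists_isLeast_int {P : ℤ → Prop} (hup : ∀ m n, m ≤ n → P m → P n) (h1 : ∃ n, P n)
    (h2 : ∃ n, ¬ P n) : ∃ k, ∀ n, k ≤ n ↔ P n := by
  obtain ⟨b, hb⟩ := h2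
  obtain ⟨k, hk, hmin⟩ := Int.exists_least_of_bdd (P := P)
    ⟨b, fun z hz => le_of_not_ge fun h => hb (hup z b h hz)⟩ h1
  exact ⟨k, fun n => ⟨fun h => hup k n h hk, hmin n⟩⟩

lemma tendsto_measureReal_Iic_int_atTop (ν : Measure ℤ) [IsProbabilityMeasure ν] :
    Filter.Tendsto (fun n : ℤ => ν.real (Iic n)) Filter.atTop (nhds 1) := by
  have h := tendsto_measure_iUnion_atTop (μ := ν) (s := fun n : ℤ => Iic n)
    (fun a b hab => Iic_subset_Iic.2 hab)
  rw [iUnion_Iic, measure_univ] at h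
  exact (ENNReal.tendsto_toReal ENNReal.one_ne_top).comp h

lemma tendsto_measureReal_Iic_int_atBot (ν : Measure ℤ) [IsProbabilityMeasure ν] :
    Filter.Tendsto (fun n : ℤ => ν.real (Iic n)) Filter.atBot (nhds 0) := by
  have h := tendsto_measure_iInter_atBot (μ := ν) (s := fun n : ℤ => Iic n)
    (fun n => measurableSet_Iic.nullMeasurableSet)
    (fun a b hab => Iic_subset_Iic.2 hab) ⟨0, measure_ne_top _ _⟩
  rw [iInter_Iic_eq_empty_iff.2 (by simp), measure_empty] at h
  exact (ENNReal.tendsto_toReal ENNReal.zero_ne_top).comp h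

lemma monotone_measureReal_Iic (ν : Measure ℤ) [IsProbabilityMeasure ν] :
    Monotone (fun n : ℤ => ν.real (Iic n)) :=
  fun _ _ h => measureReal_mono (Iic_subset_Iic.2 h)

/-- Quantile functions: every probability measure on `ℤ` is a monotone image of Lebesgue measure
on the unit interval. -/
lemma exists_quantile (ν : Measure ℤ) [IsProbabilityMeasure ν] :
    ∃ X : ℝ → ℤ, Measurable X ∧ (∀ u ∈ Ioo (0 : ℝ) 1, ∀ n, X u ≤ n ↔ u ≤ ν.real (Iic n)) ∧
      (volume.restrict (Ioo (0 : ℝ) 1)).map X = ν := by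
  have hex : ∀ u : ℝ, ∃ k : ℤ, u ∈ Ioo (0 : ℝ) 1 → ∀ n, k ≤ n ↔ u ≤ ν.real (Iic n) := by
    intro u
    by_cases hu : u ∈ Ioo (0 : ℝ) 1
    · obtain ⟨k, hk⟩ := exists_isLeast_int (P := fun n => u ≤ ν.real (Iic n))
        (fun m n hmn h => h.trans (monotone_measureReal_Iic ν hmn))
        (((tendsto_measureReal_Iic_int_atTop ν).eventually (lt_mem_nhds hu.2)).exists.imp
          fun _ h => h.le)
        (((tendsto_measureReal_Iic_int_atBot ν).eventually (gt_mem_nhds hu.1)).exists.imp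
          fun _ h => h.not_ge)
      exact ⟨k, fun _ => hk⟩
    · exact ⟨0, fun h => absurd h hu⟩
  choose Y hY using hex
  classical
  set X : ℝ → ℤ := fun u => if u ∈ Ioo (0 : ℝ) 1 then Y u else 0 with hXdef
  have hX : ∀ u ∈ Ioo (0 : ℝ) 1, ∀ n, X u ≤ n ↔ u ≤ ν.real (Iic n) := by
    intro u hu n
    rw [hXdef]
    simp only [if_pos hu]
    exact hY u hu n
  have hmeas : Measurable X := by
    refine measurable_of_Iic fun n => ?_
    have : X ⁻¹' Iic n = (Ioo (0 : ℝ) 1 ∩ Iic (ν.real (Iic n))) ∪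
        ((Ioo (0 : ℝ) 1)ᶜ ∩ {_u | (0 : ℤ) ≤ n}) := by
      ext u
      by_cases hu : u ∈ Ioo (0 : ℝ) 1
      · have := hX u hu n
        simp only [mem_preimage, mem_Iic, mem_union, mem_inter_iff, mem_compl_iff, hu, this]
        simp
      · have : X u = 0 := if_neg hu
        simp only [mem_preimage, mem_Iic, mem_union, mem_inter_iff, mem_compl_iff, hu, this]
        simp
    rw [this]
    exact (measurableSet_Ioo.inter measurableSet_Iic).union
      (measurableSet_Ioo.compl.inter (MeasurableSet.const _))
  refine ⟨X, hmeas, hX, ?_⟩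
  have : IsProbabilityMeasure (volume.restrict (Ioo (0 : ℝ) 1)) := ⟨by simp⟩
  have := Measure.isProbabilityMeasure_map (μ := volume.restrict (Ioo (0 : ℝ) 1))
    hmeas.aemeasurable
  refine Measure.ext_of_Iic _ _ fun n => ?_
  rw [Measure.map_apply hmeas measurableSet_Iic, Measure.restrict_apply (hmeas measurableSet_Iic)]
  have hset : X ⁻¹' Iic n ∩ Ioo (0 : ℝ) 1 = Ioo 0 1 ∩ Iic (ν.real (Iic n)) := by
    ext u
    constructor
    · rintro ⟨h, hu⟩
      exact ⟨hu, (hX u hu n).1 h⟩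
    · rintro ⟨hu, h⟩
      exact ⟨(hX u hu n).2 h, hu⟩
  have hle : ν.real (Iic n) ≤ 1 := measureReal_le_one
  rw [hset, ← ofReal_measureReal (μ := ν)]
  apply le_antisymm
  · calc volume (Ioo 0 1 ∩ Iic (ν.real (Iic n))) ≤ volume (Ioc 0 (ν.real (Iic n))) :=
          measure_mono fun u hu => ⟨hu.1.1, hu.2⟩
      _ = _ := by rw [Real.volume_Ioc, sub_zero]
  · calc ENNReal.ofReal (ν.real (Iic n)) = volume (Ioo 0 (ν.real (Iic n))) := by
          rw [Real.volume_Ioo, sub_zero]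
      _ ≤ _ := by
          rw [inter_comm]
          exact measure_mono fun u hu => ⟨hu.2.le, hu.1, hu.2.trans_le hle⟩

/-- The comonotone coupling of two probability measures on `ℤ` lives on a lattice path
`s ↦ (x s, y s)` with `x` and `y` monotone and `x s + y s = s`. -/
lemma exists_lattice_path_coupling (ν₀ ν₁ : Measure ℤ) [IsProbabilityMeasure ν₀]
    [IsProbabilityMeasure ν₁] :
    ∃ (ρ : Measure ℤ) (x y : ℤ → ℤ), IsProbabilityMeasure ρ ∧ Monotone x ∧ Monotone y ∧
      (∀ s, x s + y s = s) ∧ ρ.map x = ν₀ ∧ ρ.map y = ν₁ := by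
  obtain ⟨X, hXm, hX, hX0⟩ := exists_quantile ν₀
  obtain ⟨Y, hYm, hY, hY1⟩ := exists_quantile ν₁
  have hF0 := monotone_measureReal_Iic ν₀
  have hF1 := monotone_measureReal_Iic ν₁
  -- If `X u + Y u = s`, the level `u` separates the two sides: at `n = X u`, `F₁(Y u - 1) < u ≤
  -- F₀(X u)`; at `n = X u - 1`, `F₀(X u - 1) < u ≤ F₁(Y u)`. The least such `n` thus recovers `X u`
  -- from the sum, and it makes sense for every `s`.
  have hex : ∀ s : ℤ, ∃ k : ℤ, ∀ n, k ≤ n ↔ ν₁.real (Iic (s - n - 1)) < ν₀.real (Iic n) := by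
    intro s
    have ht : Filter.Tendsto (fun n : ℤ => s - n - 1) Filter.atTop Filter.atBot := by
      refine Filter.tendsto_atBot.2 fun b => ?_
      filter_upwards [Filter.eventually_ge_atTop (s - 1 - b)] with n hn
      omega
    have hb : Filter.Tendsto (fun n : ℤ => s - n - 1) Filter.atBot Filter.atTop := by
      refine Filter.tendsto_atTop.2 fun b => ?_
      filter_upwards [Filter.eventually_le_atBot (s - 1 - b)] with n hn
      omega
    refine exists_isLeast_int ?_ ?_ ?_
    · intro m n hmn h
      exact ((hF1 (show s - n - 1 ≤ s - m - 1 by omega)).trans_lt h).trans_le (hF0 hmn)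
    · exact (((tendsto_measureReal_Iic_int_atBot ν₁).comp ht).eventually_lt
        (tendsto_measureReal_Iic_int_atTop ν₀) zero_lt_one).exists
    · exact ((tendsto_measureReal_Iic_int_atBot ν₀).eventually_lt
        ((tendsto_measureReal_Iic_int_atTop ν₁).comp hb) zero_lt_one).exists.imp
        fun _ h => h.not_gt
  choose x hx using hex
  have hx1 : ∀ s, x s ≤ x (s + 1) := by
    intro s
    rw [hx s]
    have h := (hx (s + 1) (x (s + 1))).1 le_rfl
    exact (hF1 (show s - x (s + 1) - 1 ≤ s + 1 - x (s + 1) - 1 by omega)).trans_lt h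
  -- This is monotonicity of `s ↦ s - x s`.
  have hx2 : ∀ s, x (s + 1) ≤ x s + 1 := by
    intro s
    rw [hx (s + 1)]
    have h := (hx s (x s)).1 le_rfl
    rw [show s + 1 - (x s + 1) - 1 = s - x s - 1 by ring]
    exact h.trans_le (hF0 (by omega))
  have hpath : ∀ u ∈ Ioo (0 : ℝ) 1, x (X u + Y u) = X u := by
    intro u hu
    apply le_antisymm
    · rw [hx, show X u + Y u - X u - 1 = Y u - 1 by ring]
      have h1 : ν₁.real (Iic (Y u - 1)) < u := by
        rw [← not_le, ← hY u hu]
        omega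
      exact h1.trans_le ((hX u hu _).1 le_rfl)
    · have h1 : ν₀.real (Iic (X u - 1)) < u := by
        rw [← not_le, ← hX u hu]
        omega
      have h2 := (hY u hu (Y u)).1 le_rfl
      by_contra hlt
      have h3 := (hx (X u + Y u) (X u - 1)).1 (by omega)
      rw [show X u + Y u - (X u - 1) - 1 = Y u by ring] at h3
      linarith
  have hSm : Measurable fun u => X u + Y u := hXm.add hYm
  have hprob : IsProbabilityMeasure (volume.restrict (Ioo (0 : ℝ) 1)) := ⟨by simp⟩
  refine ⟨(volume.restrict (Ioo (0 : ℝ) 1)).map fun u => X u + Y u, x, fun s => s - x s,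
    Measure.isProbabilityMeasure_map hSm.aemeasurable, monotone_int_of_le_succ hx1,
    monotone_int_of_le_succ fun s => ?_, fun s => by ring, ?_, ?_⟩
  · have := hx2 s
    omega
  · rw [Measure.map_map (measurable_of_countable _) hSm, ← hX0]
    refine Measure.map_congr ?_
    filter_upwards [ae_restrict_mem measurableSet_Ioo] with u hu
    exact hpath u hu
  · rw [Measure.map_map (measurable_of_countable _) hSm, ← hY1]
    refine Measure.map_congr ?_
    filter_upwards [ae_restrict_mem measurableSet_Ioo] with u hu
    have := hpath u hu
    simp only [Function.comp_apply]
    omega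

/-! ### Integration of the midpoint cost -/

lemma integrable_and_integral_le_one {Z : Type*} [MeasurableSpace Z] {π : Measure Z} {g : Z → ℝ}
    (hg : Measurable g) (h0 : ∀ z, 0 ≤ g z) (h : ∫⁻ z, ENNReal.ofReal (g z) ∂π ≤ 1) :
    Integrable g π ∧ ∫ z, g z ∂π ≤ 1 := by
  refine ⟨⟨hg.aestronglyMeasurable, ?_⟩, ?_⟩
  · rw [hasFiniteIntegral_iff_ofReal (Filter.Eventually.of_forall h0)]
    exact h.trans_lt ENNReal.one_lt_top
  · rw [integral_eq_lintegral_of_nonneg_ae (Filter.Eventually.of_forall h0)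
      hg.aestronglyMeasurable]
    exact ENNReal.toReal_le_of_le_ofReal zero_le_one (by simpa using h)

/-- An integrable upper bound controls the positive part; if the negative part diverges, the
extended integral is `-∞` and the bound is trivial. -/
lemma hasExtIntegral_and_extIntegral_le {Z : Type*} [MeasurableSpace Z] {π : Measure Z}
    {c D : Z → ℝ} (hc : Measurable c) (hD : Integrable D π) (hcD : ∀ᵐ z ∂π, c z ≤ D z) :
    HasExtIntegral c π ∧ extIntegral c π ≤ ((∫ z, D z ∂π : ℝ) : EReal) := by
  have hpos : ∫⁻ z, ENNReal.ofReal (c z) ∂π ≠ ∞ := by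
    refine ((lintegral_mono_ae ?_).trans_lt hD.lintegral_lt_top).ne
    filter_upwards [hcD] with z hz
    exact ENNReal.ofReal_le_ofReal hz
  refine ⟨Or.inl hpos, ?_⟩
  unfold extIntegral
  by_cases hneg : ∫⁻ z, ENNReal.ofReal (-c z) ∂π = ∞
  · rw [hneg]
    simp
  · have hci : Integrable c π := by
      have hp : Integrable (fun z => max (c z) 0) π := by
        refine ⟨(hc.max measurable_const).aestronglyMeasurable, ?_⟩
        rw [hasFiniteIntegral_iff_ofReal (ae_of_all _ fun z => by positivity)]
        simpa [ENNReal.ofReal_max] using hpos.lt_top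
      have hn : Integrable (fun z => max (-c z) 0) π := by
        refine ⟨(hc.neg.max measurable_const).aestronglyMeasurable, ?_⟩
        rw [hasFiniteIntegral_iff_ofReal (ae_of_all _ fun z => by positivity)]
        simpa [ENNReal.ofReal_max] using Ne.lt_top hneg
      refine (hp.sub hn).congr (Filter.Eventually.of_forall fun z => ?_)
      exact max_zero_sub_max_neg_zero_eq_self (c z)
    have h := integral_mono_ae hci hD hcD
    rw [integral_eq_lintegral_pos_part_sub_lintegral_neg_part hci] at h
    rw [← EReal.coe_ennreal_toReal hpos, ← EReal.coe_ennreal_toReal hneg, ← EReal.coe_sub]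
    exact EReal.coe_le_coe_iff.2 h

lemma llr_eq_log_div_singleton {μ ν : Measure ℤ} [IsFiniteMeasure μ] [IsFiniteMeasure ν]
    (hμ : ∀ x : ℤ, 0 < μ {x}) (n : ℤ) :
    llr ν μ n = Real.log (ν.real {n} / μ.real {n}) := by
  have hac : ν ≪ μ := by
    intro s hs
    have : s = ∅ := by
      refine eq_empty_of_forall_notMem fun x hx => (hμ x).ne' ?_
      exact measure_mono_null (singleton_subset_iff.2 hx) hs
    simp [this]
  have h : ν {n} = ν.rnDeriv μ n * μ {n} := by
    rw [← Measure.setLIntegral_rnDeriv hac {n}, lintegral_singleton]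
  have hreal : ν.real {n} = (ν.rnDeriv μ n).toReal * μ.real {n} := by
    rw [measureReal_def, h, ENNReal.toReal_mul, measureReal_def]
  have hpos : 0 < μ.real {n} := ENNReal.toReal_pos (hμ n).ne' (measure_ne_top _ _)
  rw [llr, hreal, mul_div_cancel_right₀ _ hpos.ne']

/-- The two fibres through `s` are `{s - 1, s}` and `{s, s + 1}`; parity decides only which is
which. -/
lemma real_map_half_mul_real_map_half_succ (ρ : Measure ℤ) [IsFiniteMeasure ρ] (s : ℤ) :
    (ρ.map fun t => t / 2).real {s / 2} * (ρ.map fun t => (t + 1) / 2).real {(s + 1) / 2} =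
      (ρ.real {s - 1} + ρ.real {s}) * (ρ.real {s} + ρ.real {s + 1}) := by
  have hpair : ∀ a b : ℤ, a ≠ b → ρ.real {a, b} = ρ.real {a} + ρ.real {b} := by
    intro a b hab
    rw [insert_eq, measureReal_union (by simpa using hab) (measurableSet_singleton b)]
  rw [map_measureReal_apply (measurable_of_countable _) (measurableSet_singleton _),
    map_measureReal_apply (measurable_of_countable _) (measurableSet_singleton _),
    ← hpair _ _ (by omega), ← hpair _ _ (by omega)]
  rcases Int.even_or_odd' s with ⟨k, hk | hk⟩
  · rw [mul_comm]
    congr 2 <;> ext t <;> simp only [mem_preimage, mem_singleton_iff, mem_insert_iff] <;> omega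
  · congr 2 <;> ext t <;> simp only [mem_preimage, mem_singleton_iff, mem_insert_iff] <;> omega

lemma floor_half_intCast (s : ℤ) : ⌊(s : ℝ) / 2⌋ = s / 2 := by
  rw [Int.floor_eq_iff]
  have h1 : ((2 * (s / 2) : ℤ) : ℝ) ≤ s := Int.cast_le.2 (by omega)
  have h2 : (s : ℝ) < ((2 * (s / 2) + 2 : ℤ) : ℝ) := Int.cast_lt.2 (by omega)
  push_cast at h1 h2
  constructor <;> linarith

lemma ceil_half_intCast (s : ℤ) : ⌈(s : ℝ) / 2⌉ = (s + 1) / 2 := by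
  rw [Int.ceil_eq_iff]
  have h1 : (s : ℝ) ≤ ((2 * ((s + 1) / 2) : ℤ) : ℝ) := Int.cast_le.2 (by omega)
  have h2 : ((2 * ((s + 1) / 2) - 2 : ℤ) : ℝ) < s := Int.cast_lt.2 (by omega)
  push_cast at h1 h2
  constructor <;> linarith

lemma midpointCost_path_le (μ ρ : Measure ℤ) [IsProbabilityMeasure μ] [IsProbabilityMeasure ρ]
    (hμ : ∀ n : ℤ, 0 < μ {n}) {x y : ℤ → ℤ} (hxy : ∀ s, x s + y s = s) {s : ℤ}
    (hs : 0 < ρ.real {s}) :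
    midpointCost μ (x s, y s) ≤ llr (ρ.map x) μ (x s) + llr (ρ.map y) μ (y s) +
      (midpointRatio ρ x y s - 1) +
      (μ.real {s / 2} / (ρ.map fun t => t / 2).real {s / 2} - 1) +
      (μ.real {(s + 1) / 2} / (ρ.map fun t => (t + 1) / 2).real {(s + 1) / 2} - 1) := by
  have hμ' : ∀ n, 0 < μ.real {n} := fun n => ENNReal.toReal_pos (hμ n).ne' (measure_ne_top _ _)
  have hf : ∀ f : ℤ → ℤ, 0 < (ρ.map f).real {f s} := fun f => by
    have := sum_real_singleton_le_map ρ f (f s) {s} (by simp)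
    rw [Finset.sum_singleton] at this
    exact hs.trans_le this
  have ha := hf x
  have hb := hf y
  have hq : 0 < (ρ.map fun t => t / 2).real {s / 2} := hf _
  have hq' : 0 < (ρ.map fun t => (t + 1) / 2).real {(s + 1) / 2} := hf fun t => (t + 1) / 2
  rw [llr_eq_log_div_singleton hμ, llr_eq_log_div_singleton hμ, midpointRatio,
    ← real_map_half_mul_real_map_half_succ]
  unfold midpointCost
  simp only
  rw [← Int.cast_add, hxy, floor_half_intCast, ceil_half_intCast]
  have hμx := hμ' (x s)
  have hμy := hμ' (y s)
  have hμm := hμ' (s / 2)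
  have hμm' := hμ' ((s + 1) / 2)
  generalize (ρ.map x).real {x s} = a at *
  generalize (ρ.map y).real {y s} = b at *
  generalize (ρ.map fun t => t / 2).real {s / 2} = q at *
  generalize (ρ.map fun t => (t + 1) / 2).real {(s + 1) / 2} = q' at *
  have l1 := Real.log_le_sub_one_of_pos (show 0 < q * q' / (a * b) by positivity)
  have l2 := Real.log_le_sub_one_of_pos (show 0 < μ.real {s / 2} / q by positivity)
  have l3 := Real.log_le_sub_one_of_pos (show 0 < μ.real {(s + 1) / 2} / q' by positivity)
  rw [Real.log_div (by positivity) (by positivity), Real.log_mul (by positivity) (by positivity),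
    Real.log_mul (by positivity) (by positivity)] at l1
  rw [Real.log_div (by positivity) (by positivity)] at l2 l3
  rw [Real.log_div (by positivity) (by positivity), Real.log_mul (by positivity) (by positivity),
    Real.log_mul (by positivity) (by positivity), Real.log_div (by positivity) (by positivity),
    Real.log_div (by positivity) (by positivity)]
  linarith

/-! ### The transport-entropy inequality -/

theorem mainTheorem8 (μ : MeasureTheory.Measure ℤ) [MeasureTheory.IsProbabilityMeasure μ]
    (hμ : ∀ x : ℤ, 0 < μ {x})
    (ν₀ ν₁ : MeasureTheory.Measure ℤ) [MeasureTheory.IsProbabilityMeasure ν₀]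
    [MeasureTheory.IsProbabilityMeasure ν₁] :
    transportCost (midpointCost μ) ν₀ ν₁ ≤
      ((InformationTheory.klDiv ν₀ μ : ENNReal) : EReal) +
        ((InformationTheory.klDiv ν₁ μ : ENNReal) : EReal) := by
  by_cases h0 : InformationTheory.klDiv ν₀ μ = ∞
  · rw [h0, EReal.coe_ennreal_top, EReal.top_add_of_ne_bot (EReal.coe_ennreal_ne_bot _)]
    exact le_top
  by_cases h1 : InformationTheory.klDiv ν₁ μ = ∞
  · rw [h1, EReal.coe_ennreal_top, EReal.add_top_of_ne_bot (EReal.coe_ennreal_ne_bot _)]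
    exact le_top
  obtain ⟨hac0, hi0⟩ := InformationTheory.klDiv_ne_top_iff.1 h0
  obtain ⟨hac1, hi1⟩ := InformationTheory.klDiv_ne_top_iff.1 h1
  -- Equal total masses: the divergence is the plain integral of `llr`, with no mass correction.
  have e0 := InformationTheory.toReal_klDiv_of_measure_eq hac0 (by simp)
  have e1 := InformationTheory.toReal_klDiv_of_measure_eq hac1 (by simp)
  rw [← EReal.coe_ennreal_toReal h0, ← EReal.coe_ennreal_toReal h1, e0, e1, ← EReal.coe_add]
  obtain ⟨ρ, x, y, hρ, hx, hy, hxy, rfl, rfl⟩ := exists_lattice_path_coupling ν₀ ν₁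
  have hxm : Measurable x := measurable_of_countable x
  have hym : Measurable y := measurable_of_countable y
  have hpm : Measurable fun s => (x s, y s) := hxm.prodMk hym
  obtain ⟨i1, j1⟩ := integrable_and_integral_le_one (measurable_of_countable _)
    (midpointRatio_nonneg ρ x y) (lintegral_midpointRatio_le ρ hx hy hxy)
  obtain ⟨i2, j2⟩ := integrable_and_integral_le_one (measurable_of_countable _)
    (fun s => by positivity) (lintegral_ratio_map_le ρ μ fun t => t / 2)
  obtain ⟨i3, j3⟩ := integrable_and_integral_le_one (measurable_of_countable _)
    (fun s => by positivity) (lintegral_ratio_map_le ρ μ fun t => (t + 1) / 2)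
  have k0 : Integrable (fun s => llr (ρ.map x) μ (x s)) ρ := hi0.comp_measurable hxm
  have k1 : Integrable (fun s => llr (ρ.map y) μ (y s)) ρ := hi1.comp_measurable hym
  have hle : ∀ᵐ s ∂ρ, midpointCost μ (x s, y s) ≤ llr (ρ.map x) μ (x s) + llr (ρ.map y) μ (y s) +
      (midpointRatio ρ x y s - 1) +
      (μ.real {s / 2} / (ρ.map fun t => t / 2).real {s / 2} - 1) +
      (μ.real {(s + 1) / 2} / (ρ.map fun t => (t + 1) / 2).real {(s + 1) / 2} - 1) := by
    rw [ae_iff_of_countable]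
    intro s hs
    exact midpointCost_path_le μ ρ hμ hxy (ENNReal.toReal_pos hs (measure_ne_top _ _))
  have hDint := (((k0.add k1).add (i1.sub (integrable_const 1))).add
    (i2.sub (integrable_const 1))).add (i3.sub (integrable_const 1))
  obtain ⟨hH, hE⟩ := hasExtIntegral_and_extIntegral_le (measurable_of_countable _) hDint hle
  have hcm : Measurable (midpointCost μ) := measurable_of_countable _
  have hext : extIntegral (midpointCost μ) (ρ.map fun s => (x s, y s)) =
      extIntegral (fun s => midpointCost μ (x s, y s)) ρ := by
    unfold extIntegral
    rw [lintegral_map (measurable_of_countable _) hpm,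
      lintegral_map (measurable_of_countable _) hpm]
  have hmem : (ρ.map fun s => (x s, y s)) ∈ {π ∈ couplings (ρ.map x) (ρ.map y) |
      HasExtIntegral (midpointCost μ) π} := by
    refine ⟨⟨Measure.isProbabilityMeasure_map hpm.aemeasurable, ?_, ?_⟩, ?_⟩
    · rw [Measure.map_map measurable_fst hpm]
      rfl
    · rw [Measure.map_map measurable_snd hpm]
      rfl
    · unfold HasExtIntegral
      rw [lintegral_map (measurable_of_countable _) hpm,
        lintegral_map (measurable_of_countable _) hpm]
      exact hH
  refine (iInf₂_le _ hmem).trans ?_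
  rw [hext]
  refine hE.trans (EReal.coe_le_coe_iff.2 ?_)
  rw [integral_map hxm.aemeasurable (measurable_of_countable _).aestronglyMeasurable,
    integral_map hym.aemeasurable (measurable_of_countable _).aestronglyMeasurable]
  have m1 : ∫ s, (midpointRatio ρ x y s - 1) ∂ρ ≤ 0 := by
    rw [integral_sub i1 (integrable_const 1)]
    simpa using j1
  have m2 : ∫ s, (μ.real {s / 2} / (ρ.map fun t => t / 2).real {s / 2} - 1) ∂ρ ≤ 0 := by
    rw [integral_sub i2 (integrable_const 1)]
    simpa using j2
  have m3 : ∫ s, (μ.real {(s + 1) / 2} / (ρ.map fun t => (t + 1) / 2).real {(s + 1) / 2} - 1) ∂ρ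
      ≤ 0 := by
    rw [integral_sub i3 (integrable_const 1)]
    simpa using j3
  have hsum := integral_add (((k0.add k1).add (i1.sub (integrable_const 1))).add
    (i2.sub (integrable_const 1))) (i3.sub (integrable_const 1))
  have hsum2 := integral_add ((k0.add k1).add (i1.sub (integrable_const 1)))
    (i2.sub (integrable_const 1))
  have hsum1 := integral_add (k0.add k1) (i1.sub (integrable_const 1))
  have hsum0 := integral_add k0 k1
  simp only [Pi.add_apply, Pi.sub_apply] at hsum hsum2 hsum1 hsum0 ⊢
  linarith
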